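/- Let $S=k[x_1,\dots,x_n]$ be a polynomial ring over a field $k$ and let $M\subseteq S$ be a monomial ideal with minimal monomial generating set $G$. A generator $g\in G$ is called dominant if there is a variable $x$ whose exponent in $g$ is larger than its exponent in every other element of $G$. Let $d\ge 1$ and write $G=\{m_1,\dots,m_d,h_1,\dots,h_c\}$ with distinct elements, where $m_1,\dots,m_d$ are dominant (the $h_i$ may be dominant or not, and $c\ge 0$). For a monomial ideal $I$, an integer $i$ and a Laurent monomial $u$, let $\beta_{i,u}(S/I)$ be the number of basis elements of homological degree $i$ and multidegree $u$ in a minimal multigraded free resolution of $S/I$; in particular it is $0$ if $i<0$ or if $u$ is not a monomial of $S$. If $c>0$, let $$C=\{(0,1)\}\cup\{(j,m) : j\ge 1 \text{ and } m=\operatorname{lcm}(m_{r_1},\dots,m_{r_j}) \text{ for some } 1\le r_1<\dots<r_j\le d\},$$ and for $(j,m)\in C$ let $M_m$ be the ideal generated by the monomials $\operatorname{lcm}(m,h_i)/m$, $i=1,\dots,c$. If $c=0$, let $C=\{(0,1)\}$ and $M_1=M$. Then for every integer $k$ and every monomial $l$ of $S$, $$\beta_{k,l}(S/M)=\sum_{(j,m)\in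 C}\beta_{k-j,\,l/m}(S/M_m).$$ -/

import Mathlib

/-!
Conventions.  `S = MvPolynomial σ K` is the polynomial ring in the variables indexed by the finite
type `σ`.  A monomial of `S` is represented by its exponent vector `σ →₀ ℕ`: the monomial `1` is
`0`, products are sums, divisibility is `≤`, the least common multiple is `⊔`, and the exact
quotient of a monomial by a divisor is `-`.
-/

namespace MonomialBetti

open MvPolynomial

/-- The ideal of `K[x_i : i ∈ σ]` generated by the monomials with exponent vectors in `G`. -/
noncomputable def monomialIdeal {σ : Type*} (K : Type*) [Field K] (G : Set (σ →₀ ℕ)) :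
    Ideal (MvPolynomial σ K) :=
  Ideal.span ((fun s => monomial s (1 : K)) '' G)

/-- `G` is a minimal generating set of monomials of the ideal `M`. -/
def IsMinimalGeneratingSet {σ K : Type*} [Field K] (M : Ideal (MvPolynomial σ K))
    (G : Set (σ →₀ ℕ)) : Prop :=
  monomialIdeal K G = M ∧ ∀ G' ⊂ G, monomialIdeal K G' ≠ M

/-- The monomial `m` is dominant in the set `G` of monomials: some variable appears in `m` with
an exponent larger than its exponent in every other element of `G`. -/
def IsDominant {σ : Type*} (G : Set (σ →₀ ℕ)) (m : σ →₀ ℕ) : Prop :=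
  m ∈ G ∧ ∃ x : σ, ∀ m' ∈ G, m' ≠ m → m' x < m x

/-- A multigraded free resolution of `S / I`
`⋯ → S ^ rank 2 → S ^ rank 1 → S ^ rank 0 → S / I → 0`
by free modules of finite rank.  The `b`-th basis element of the `i`-th module has multidegree
`mdeg i b`, the map from the `i + 1`-st to the `i`-th module has matrix `d i`, and all maps
preserve multidegrees. -/
structure MultigradedResolution {σ K : Type*} [Field K] (I : Ideal (MvPolynomial σ K)) where
  rank : ℕ → ℕ
  mdeg : ∀ i, Fin (rank i) → (σ →₀ ℕ)
  d : ∀ i, Matrix (Fin (rank i)) (Fin (rank (i + 1))) (MvPolynomial σ K)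
  aug : (Fin (rank 0) → MvPolynomial σ K) →ₗ[MvPolynomial σ K] (MvPolynomial σ K ⧸ I)
  /-- The `(a, b)` entry is a scalar multiple of the monomial `mdeg b / mdeg a`
  (it is zero if `mdeg a` does not divide `mdeg b`). -/
  d_homogeneous : ∀ i a b, ∃ c : K,
    monomial (mdeg i a) 1 * d i a b = monomial (mdeg (i + 1) b) c
  aug_homogeneous : ∀ b, ∃ c : K,
    aug (Pi.single b 1) = Ideal.Quotient.mk I (monomial (mdeg 0 b) c)
  aug_surjective : Function.Surjective aug
  exact_zero : Function.Exact (d 0).mulVecLin aug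
  exact_succ : ∀ i, Function.Exact (d (i + 1)).mulVecLin (d i).mulVecLin

/-- A resolution is minimal if its differential matrices have no invertible entries. -/
def MultigradedResolution.IsMinimal {σ K : Type*} [Field K] {I : Ideal (MvPolynomial σ K)}
    (F : MultigradedResolution I) : Prop :=
  ∀ i a b, ¬ IsUnit (F.d i a b)

/-- The number of basis elements of `F` of homological degree `k` and multidegree `l`.  The
homological degree and the exponents of `l` may be arbitrary integers; the number is `0` if one of
them is negative. -/
noncomputable def MultigradedResolution.numBasis {σ K : Type*} [Field K]
    {I : Ideal (MvPolynomial σ K)} (F : MultigradedResolution I) (k : ℤ) (l : σ → ℤ) : ℕ :=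
  Nat.card {e : Σ i, Fin (F.rank i) // (e.1 : ℤ) = k ∧ ∀ x, (F.mdeg e.1 e.2 x : ℤ) = l x}

/-! ### Existence of minimal multigraded free resolutions of monomial ideals -/

section Existence

variable {σ K : Type*} [Field K]

/-- The component of multidegree `l` of an element of a multigraded free module whose basis
elements have multidegrees `a`. -/
noncomputable def component {n : ℕ} (a : Fin n → (σ →₀ ℕ)) (l : σ →₀ ℕ)
    (v : Fin n → MvPolynomial σ K) : Fin n → MvPolynomial σ K :=
  open Classical in
  fun b => if a b ≤ l then monomial (l - a b) (coeff (l - a b) (v b)) else 0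

theorem monomial_mul_component {n : ℕ} (a : Fin n → (σ →₀ ℕ)) (l : σ →₀ ℕ)
    (v : Fin n → MvPolynomial σ K) (b : Fin n) :
    monomial (a b) 1 * component a l v b =
      monomial l (coeff l (monomial (a b) (1 : K) * v b)) := by
  classical
  rw [coeff_monomial_mul', component]
  split_ifs with h
  · rw [monomial_mul, add_tsub_cancel_of_le h]
  · simp

theorem mulVec_component {n n' : ℕ} (a : Fin n → (σ →₀ ℕ)) (a' : Fin n' → (σ →₀ ℕ))
    (A : Matrix (Fin n) (Fin n') (MvPolynomial σ K))
    (hA : ∀ b c, ∃ r : K, monomial (a b) 1 * A b c = monomial (a' c) r)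
    (l : σ →₀ ℕ) (v : Fin n' → MvPolynomial σ K) :
    A.mulVec (component a' l v) = component a l (A.mulVec v) := by
  choose r hr using hA
  funext b
  have hne : (monomial (a b) (1 : K) : MvPolynomial σ K) ≠ 0 := by simp
  apply mul_left_cancel₀ hne
  have key : ∀ w : Fin n' → MvPolynomial σ K, monomial (a b) 1 * A.mulVec w b =
      ∑ c, C (r b c) * (monomial (a' c) 1 * w c) := by
    intro w
    rw [Matrix.mulVec, dotProduct, Finset.mul_sum]
    refine Finset.sum_congr rfl fun c _ => ?_
    rw [← mul_assoc, hr, ← mul_assoc, C_mul_monomial, mul_one]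
  rw [monomial_mul_component, key, key, coeff_sum, map_sum]
  refine Finset.sum_congr rfl fun c _ => ?_
  rw [monomial_mul_component, coeff_C_mul, C_mul_monomial]

theorem eq_sum_component {n : ℕ} (a : Fin n → (σ →₀ ℕ)) (v : Fin n → MvPolynomial σ K) :
    ∃ L : Finset (σ →₀ ℕ), v = ∑ l ∈ L, component a l v := by
  classical
  refine ⟨Finset.univ.biUnion fun b => (monomial (a b) (1 : K) * v b).support, ?_⟩
  funext b
  have hne : (monomial (a b) (1 : K) : MvPolynomial σ K) ≠ 0 := by simp
  apply mul_left_cancel₀ hne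
  rw [Finset.sum_apply, Finset.mul_sum]
  simp_rw [monomial_mul_component]
  conv_lhs => rw [(monomial (a b) (1 : K) * v b).as_sum]
  refine Finset.sum_subset ?_ ?_
  · exact Finset.subset_biUnion_of_mem (fun b => (monomial (a b) (1 : K) * v b).support)
      (Finset.mem_univ b)
  · intro l _ hl
    rw [notMem_support_iff.mp hl, map_zero]

/-- A multigraded submodule of the free module on basis elements of multidegrees `a`, no element of
which has an invertible coordinate. -/
structure SyzygyModule (σ K : Type*) [Field K] where
  n : ℕ
  a : Fin n → (σ →₀ ℕ)
  P : Submodule (MvPolynomial σ K) (Fin n → MvPolynomial σ K)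
  stable : ∀ l, ∀ v ∈ P, component a l v ∈ P
  not_isUnit : ∀ v ∈ P, ∀ b, ¬ IsUnit (v b)

theorem exists_minimal_generators [Finite σ] {n : ℕ} (a : Fin n → (σ →₀ ℕ))
    (P : Submodule (MvPolynomial σ K) (Fin n → MvPolynomial σ K))
    (hP : ∀ l, ∀ v ∈ P, component a l v ∈ P) :
    ∃ (n' : ℕ) (a' : Fin n' → (σ →₀ ℕ)) (g : Fin n' → Fin n → MvPolynomial σ K),
      (∀ b c, ∃ r : K, monomial (a c) 1 * g b c = monomial (a' b) r) ∧
      Submodule.span _ (Set.range g) = P ∧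
      ∀ v : Fin n' → MvPolynomial σ K, ∑ b, v b • g b = 0 → ∀ b, ¬ IsUnit (v b) := by
  classical
  let Q : ℕ → Prop := fun n' => ∃ (a' : Fin n' → (σ →₀ ℕ)) (g : Fin n' → Fin n → MvPolynomial σ K),
      (∀ b c, ∃ r : K, monomial (a c) 1 * g b c = monomial (a' b) r) ∧
      Submodule.span (MvPolynomial σ K) (Set.range g) = P
  have hQ : ∃ n', Q n' := by
    let X : Set (Fin n → MvPolynomial σ K) := {w | ∃ l, ∃ v ∈ P, w = component a l v}
    have hX : P = Submodule.span _ X := by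
      apply le_antisymm
      · intro v hv
        obtain ⟨L, hL⟩ := eq_sum_component a v
        rw [hL]
        exact Submodule.sum_mem _ fun l _ => Submodule.subset_span ⟨l, v, hv, rfl⟩
      · rw [Submodule.span_le]
        rintro _ ⟨l, v, hv, rfl⟩
        exact hP l v hv
    have hfg : (Submodule.span (MvPolynomial σ K) X).FG := IsNoetherian.noetherian _
    obtain ⟨s, hs, hspan⟩ := (Submodule.fg_span_iff_fg_span_finset_subset X).mp hfg
    have hs' : ∀ w : s, ∃ l, ∃ v ∈ P, w.1 = component a l v := fun w => hs w.2
    choose l v hv hw using hs'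
    refine ⟨s.card, fun b => l (s.equivFin.symm b), fun b => (s.equivFin.symm b).1, ?_, ?_⟩
    · intro b c
      simp only
      rw [hw, monomial_mul_component]
      exact ⟨_, rfl⟩
    · rw [hX, hspan]
      congr 1
      ext w
      constructor
      · rintro ⟨b, rfl⟩
        exact (s.equivFin.symm b).2
      · intro h
        exact ⟨s.equivFin ⟨w, h⟩, by simp⟩
  obtain ⟨a', g, hg, hspan⟩ := Nat.find_spec hQ
  have hmin : ∀ n', Q n' → Nat.find hQ ≤ n' := fun n' h => Nat.find_min' hQ h
  generalize Nat.find hQ = N at a' g hg hspan hmin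
  refine ⟨N, a', g, hg, hspan, ?_⟩
  intro v hv b hb
  obtain _ | N := N
  · exact b.elim0
  have : Q N := by
    refine ⟨fun c => a' (b.succAbove c), fun c => g (b.succAbove c), fun c => hg _, ?_⟩
    rw [← hspan]
    apply le_antisymm
    · apply Submodule.span_mono
      rintro _ ⟨c, rfl⟩
      exact ⟨_, rfl⟩
    · rw [Submodule.span_le]
      rintro _ ⟨c, rfl⟩
      rcases Fin.eq_self_or_eq_succAbove b c with rfl | ⟨e, rfl⟩
      · rw [Fin.sum_univ_succAbove _ c] at hv
        rw [SetLike.mem_coe]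
        obtain ⟨u, hu⟩ := hb
        have h1 : v c • g c ∈ Submodule.span (MvPolynomial σ K)
            (Set.range fun e => g (c.succAbove e)) := by
          rw [eq_neg_of_add_eq_zero_left hv]
          exact Submodule.neg_mem _ (Submodule.sum_mem _ fun e _ =>
            Submodule.smul_mem _ _ (Submodule.subset_span ⟨e, rfl⟩))
        have h2 := Submodule.smul_mem _ (↑u⁻¹ : MvPolynomial σ K) h1
        rwa [← hu, smul_smul, Units.inv_mul, one_smul] at h2
      · exact Submodule.subset_span ⟨e, rfl⟩
  have := hmin N this
  omega

theorem SyzygyModule.exists_next [Finite σ] (s : SyzygyModule σ K) :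
    ∃ (t : SyzygyModule σ K) (A : Matrix (Fin s.n) (Fin t.n) (MvPolynomial σ K)),
      (∀ b c, ∃ r : K, monomial (s.a b) 1 * A b c = monomial (t.a c) r) ∧
      LinearMap.range A.mulVecLin = s.P ∧ LinearMap.ker A.mulVecLin = t.P := by
  obtain ⟨n', a', g, hg, hspan, hmin⟩ := exists_minimal_generators s.a s.P s.stable
  let A : Matrix (Fin s.n) (Fin n') (MvPolynomial σ K) := Matrix.of fun c b => g b c
  have hA : ∀ b c, ∃ r : K, monomial (s.a b) 1 * A b c = monomial (a' c) r := fun b c => hg c b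
  have hmul : ∀ v, A.mulVec v = ∑ b, v b • g b := by
    intro v
    funext c
    simp [Matrix.mulVec, dotProduct, A, mul_comm]
  refine ⟨⟨n', a', LinearMap.ker A.mulVecLin, ?_, ?_⟩, A, hA, ?_, rfl⟩
  · intro l v hv
    rw [LinearMap.mem_ker, Matrix.mulVecLin_apply] at hv ⊢
    rw [mulVec_component s.a a' A hA, hv]
    funext b
    simp [component]
  · intro v hv
    rw [LinearMap.mem_ker, Matrix.mulVecLin_apply, hmul] at hv
    exact hmin v hv
  · rw [Matrix.range_mulVecLin, ← hspan]
    rfl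

/-- For a monomial ideal `I`, there is a minimal multigraded free resolution of `S / I`. -/
theorem exists_isMinimal [Finite σ] (G : Set (σ →₀ ℕ)) :
    ∃ F : MultigradedResolution (monomialIdeal K G), F.IsMinimal := by
  classical
  set I := monomialIdeal K G with hI
  have hcomp : ∀ l, ∀ p ∈ I, (monomial l (coeff l p) : MvPolynomial σ K) ∈ I := by
    intro l p hp
    rw [hI, monomialIdeal, mem_ideal_span_monomial_image] at hp ⊢
    intro e he
    have hle : e = l ∧ coeff l p ≠ 0 := by
      rw [mem_support_iff, coeff_monomial] at he
      split_ifs at he with h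
      · exact ⟨h.symm, he⟩
      · exact absurd rfl he
    exact hp e (by rw [mem_support_iff, hle.1]; exact hle.2)
  obtain ⟨s, aug, haug, hsurj, hker⟩ : ∃ (s : SyzygyModule σ K)
      (aug : (Fin s.n → MvPolynomial σ K) →ₗ[MvPolynomial σ K] (MvPolynomial σ K ⧸ I)),
      (∀ b, ∃ c : K, aug (Pi.single b 1) = Ideal.Quotient.mk I (monomial (s.a b) c)) ∧
      Function.Surjective aug ∧ LinearMap.ker aug = s.P := by
    by_cases htop : I = ⊤
    · refine ⟨⟨0, fun b => b.elim0, ⊤, fun _ _ _ => trivial, fun _ _ b => b.elim0⟩, 0,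
        fun b => b.elim0, ?_, by simp⟩
      have : Subsingleton (MvPolynomial σ K ⧸ I) := Ideal.Quotient.subsingleton_iff.mpr htop
      intro y
      exact ⟨0, Subsingleton.elim _ _⟩
    · refine ⟨⟨1, fun _ => 0, LinearMap.ker ((Submodule.mkQ I).comp
        (LinearMap.proj 0 : (Fin 1 → MvPolynomial σ K) →ₗ[MvPolynomial σ K] _)), ?_, ?_⟩,
        (Submodule.mkQ I).comp (LinearMap.proj 0), ?_, ?_, rfl⟩
      · intro l v hv
        rw [LinearMap.mem_ker, LinearMap.comp_apply, Submodule.mkQ_apply,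
          Submodule.Quotient.mk_eq_zero] at hv ⊢
        have := hcomp l _ hv
        simpa [component] using this
      · intro v hv b hb
        rw [LinearMap.mem_ker, LinearMap.comp_apply, Submodule.mkQ_apply,
          Submodule.Quotient.mk_eq_zero] at hv
        rw [Subsingleton.elim b 0] at hb
        exact htop (Ideal.eq_top_of_isUnit_mem _ hv hb)
      · intro b
        refine ⟨1, ?_⟩
        rw [Subsingleton.elim b 0]
        simp [LinearMap.comp_apply]
      · intro y
        obtain ⟨p, rfl⟩ := Submodule.mkQ_surjective I y
        exact ⟨fun _ => p, rfl⟩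
  choose next A hA hrange hkerA using SyzygyModule.exists_next (σ := σ) (K := K)
  let f : ℕ → SyzygyModule σ K := fun i => Nat.rec s (fun _ t => next t) i
  refine ⟨⟨fun i => (f i).n, fun i => (f i).a, fun i => A (f i), aug, fun i => hA (f i), haug,
    hsurj, ?_, ?_⟩, ?_⟩
  · rw [LinearMap.exact_iff, hker]
    exact (hrange s).symm
  · intro i
    rw [LinearMap.exact_iff, hkerA]
    exact (hrange (f (i + 1))).symm
  · intro i a b
    have hmem : (A (f i)).mulVec (Pi.single b 1) ∈ (f i).P := by
      rw [← hrange (f i)]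
      exact ⟨Pi.single b 1, rfl⟩
    have := (f i).not_isUnit _ hmem a
    rwa [Matrix.mulVec_single_one] at this

end Existence

open Classical in
/-- The multigraded Betti number `β_{k,l}(S / I)` of a monomial ideal `I`: the number of basis
elements of homological degree `k` and multidegree `l` in a minimal multigraded free resolution of
`S / I`.  Such a resolution exists by `exists_isMinimal` (the value is `0` for those ideals that
are not monomial and have no such resolution). -/
noncomputable def betti {σ K : Type*} [Field K] (I : Ideal (MvPolynomial σ K)) (k : ℤ)
    (l : σ → ℤ) : ℕ :=
  if h : ∃ F : MultigradedResolution I, F.IsMinimal then h.choose.numBasis k l else 0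

/-! ### The structural decomposition -/

open Classical in
/-- The set `C` of pairs `(j, m)` where `m` is the least common multiple of `j` of the monomials
`m_1, …, m_d` with distinct indices.  The empty set of indices gives the pair `(0, 1)`, and this
is the only element of `C` if `c = 0`. -/
noncomputable def decompositionPairs {σ : Type*} {d : ℕ} (m : Fin d → (σ →₀ ℕ)) (c : ℕ) :
    Finset (ℕ × (σ →₀ ℕ)) :=
  if c = 0 then {(0, 0)}
  else Finset.univ.image fun R : Finset (Fin d) => (R.card, R.sup m)

/-- The ideal `M_m` generated by the monomials `lcm(m, h_i) / m`, for `i = 1, …, c`, and `M_1 = M`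
in the case `c = 0`. -/
noncomputable def decompositionIdeal {σ K : Type*} [Field K] (M : Ideal (MvPolynomial σ K))
    {c : ℕ} (h : Fin c → (σ →₀ ℕ)) (m : σ →₀ ℕ) : Ideal (MvPolynomial σ K) :=
  if c = 0 then M else monomialIdeal K (Set.range fun i => (m ⊔ h i) - m)

end MonomialBetti

/-!
The dominant monomials are split off one at a time.  Let `m` be a monomial and `H` a set of
monomials such that, for some variable `x`, the exponent of `x` in `m` is larger than in all
elements of `H`.  Then `betti_insert` states
`β_{k,l}(S / (m, H)) = β_{k,l}(S / H) + β_{k-1,l/m}(S / (H : m))`.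
To see this, take a minimal resolution `F` of `S / (m, H)`.  The basis elements in whose degree
the exponent of `x` is less than in `m` span a subcomplex, each of whose strands is a strand of `F`
in a truncated degree; hence it is a minimal resolution of `S / H` (`StrandResolution.lower`).  The
other basis elements have degrees divisible by `m` (`StrandResolution.IsMinimal.le_deg`) and form a
quotient complex, which, shifted by one homological degree and by the degree `m`, is a minimal
resolution of `S / (H : m)` (`StrandResolution.upper`).

The ideal `H : m` is generated by the monomials `lcm(m, g) / m`, for `g ∈ H`, and the remaining
dominant monomials, divided in this way, are dominant again.  Induction on the number of dominant
monomials gives a sum over the sets `R` of dominant monomials (`betti_image_union`); distinct sets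
have distinct least common multiples (`injective_sup`), so this is the sum over `C`.

Betti numbers are compared by strands: the component of degree `l` of a multigraded resolution is
a complex of vector spaces, with the basis elements of degree at most `l` as basis, and the
polynomial ring can be forgotten (`StrandResolution`, `MultigradedResolution.toStrand`).  That all
minimal resolutions have the same numbers of basis elements (`StrandResolution.IsMinimal.numBasis_eq`)
follows from maps between two resolutions whose composition is homotopic to the identity: modulo
maps that strictly decrease degrees, the homotopy contributes nothing.
-/

namespace MonomialBetti

/-! ### Resolutions in terms of their strands -/

/-- The span of those basis vectors, among the ones with index in `B`, whose degree is at most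
`l`. -/
def strand (K : Type*) [Field K] {P ι : Type*} [LE P] (B : Set ι) (deg : ι → P) (l : P) :
    Submodule K (ι →₀ K) :=
  Finsupp.supported K K {b | b ∈ B ∧ deg b ≤ l}

section Strand

variable {K P ι κ X : Type*} [Field K] [PartialOrder P] [AddCommGroup X] [Module K X]
  {B : Set ι} {deg : ι → P} {B' : Set κ} {deg' : κ → P}

theorem mem_strand {l : P} {v : ι →₀ K} :
    v ∈ strand K B deg l ↔ ∀ b, v b ≠ 0 → b ∈ B ∧ deg b ≤ l := by
  simp [strand, Finsupp.mem_supported, Set.subset_def]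

theorem strand_mono {l l' : P} (h : l ≤ l') : strand K B deg l ≤ strand K B deg l' := by
  intro v hv
  rw [mem_strand] at hv ⊢
  exact fun b hb => ⟨(hv b hb).1, (hv b hb).2.trans h⟩

theorem single_mem_strand {b : ι} (hb : b ∈ B) (r : K) :
    Finsupp.single b r ∈ strand K B deg (deg b) := by
  classical
  rw [mem_strand]
  intro c hc
  rw [Finsupp.single_apply] at hc
  split_ifs at hc with h
  · subst h
    exact ⟨hb, le_rfl⟩
  · exact absurd rfl hc

theorem apply_eq_zero_of_mem_strand {l : P} {v : ι →₀ K} (hv : v ∈ strand K B deg l) {b : ι}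
    (hb : ¬ deg b ≤ l) : v b = 0 := by
  by_contra h
  exact hb (mem_strand.mp hv b h).2

/-- A property closed under linear combinations holds on a strand if it holds for the basis vectors
of the strand. -/
theorem strand_le_of_single {l : P} {W : Submodule K (ι →₀ K)}
    (h : ∀ b ∈ B, deg b ≤ l → Finsupp.single b 1 ∈ W) : strand K B deg l ≤ W := by
  rw [strand, Finsupp.supported_eq_span_single, Submodule.span_le]
  rintro _ ⟨b, hb, rfl⟩
  exact h b hb.1 hb.2

/-- Extend a choice of preimages of basis vectors to a linear map that respects the degrees. -/
theorem exists_strand_lift (t : (ι →₀ K) →ₗ[K] X) (f : (κ →₀ K) →ₗ[K] X)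
    (H : ∀ b ∈ B, ∃ w ∈ strand K B' deg' (deg b), f w = t (Finsupp.single b 1)) :
    ∃ φ : (ι →₀ K) →ₗ[K] (κ →₀ K),
      (∀ l, ∀ v ∈ strand K B deg l, φ v ∈ strand K B' deg' l) ∧
      ∀ l, ∀ v ∈ strand K B deg l, f (φ v) = t v := by
  classical
  choose! w hw hf using H
  refine ⟨Finsupp.linearCombination K w, fun l => ?_, fun l => ?_⟩
  · have : strand K B deg l ≤ (strand K B' deg' l).comap (Finsupp.linearCombination K w) := by
      refine strand_le_of_single fun b hb hl => ?_
      simpa using strand_mono hl (hw b hb)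
    exact this
  · have : strand K B deg l ≤ LinearMap.eqLocus (f ∘ₗ Finsupp.linearCombination K w) t := by
      refine strand_le_of_single fun b hb hl => ?_
      simpa using hf b hb
    exact this

end Strand

/-- A multigraded free resolution of a module that has, in each degree `l`, the component `0` if
`l ∈ J` and `K` otherwise (such as `S / I`, where `J` is the set of exponents of the monomials of
`I`), described by its strands.  The free module in homological degree `i` has the basis `B i`,
and the strand of degree `l` of this module is identified with the vector space on the basis
elements of degree at most `l`, by forgetting monomial coefficients. -/
structure StrandResolution (K : Type*) [Field K] {P : Type*} [PartialOrder P] (J : Set P) where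
  ι : ℕ → Type
  B : ∀ i, Set (ι i)
  finite_B : ∀ i, (B i).Finite
  deg : ∀ i, ι i → P
  d : ∀ i, (ι (i + 1) →₀ K) →ₗ[K] (ι i →₀ K)
  /-- The augmentation; its value on the strand of degree `l` matters only for `l ∉ J`. -/
  aug : (ι 0 →₀ K) →ₗ[K] K
  d_mem : ∀ i l, ∀ v ∈ strand K (B (i + 1)) (deg (i + 1)) l, d i v ∈ strand K (B i) (deg i) l
  aug_surjective : ∀ l, l ∉ J → ∃ v ∈ strand K (B 0) (deg 0) l, aug v = 1
  exact_zero : ∀ l, ∀ v ∈ strand K (B 0) (deg 0) l,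
    (l ∈ J ∨ aug v = 0) ↔ ∃ w ∈ strand K (B 1) (deg 1) l, d 0 w = v
  exact_succ : ∀ i l, ∀ v ∈ strand K (B (i + 1)) (deg (i + 1)) l,
    d i v = 0 ↔ ∃ w ∈ strand K (B (i + 2)) (deg (i + 2)) l, d (i + 1) w = v

namespace StrandResolution

variable {K P : Type*} [Field K] [PartialOrder P] {J : Set P}

/-- The strand of degree `l` in homological degree `i`. -/
abbrev V (F : StrandResolution K J) (i : ℕ) (l : P) : Submodule K (F.ι i →₀ K) :=
  strand K (F.B i) (F.deg i) l

/-- The cycles of the strand of degree `l`, including the augmentation to `K` or `0`. -/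
def IsCycle (F : StrandResolution K J) : ∀ (i : ℕ) (_ : P), (F.ι i →₀ K) → Prop
  | 0, l, v => l ∈ J ∨ F.aug v = 0
  | i + 1, _, v => F.d i v = 0

theorem isCycle_iff (F : StrandResolution K J) {i : ℕ} {l : P} {v : F.ι i →₀ K}
    (hv : v ∈ F.V i l) : F.IsCycle i l v ↔ ∃ w ∈ F.V (i + 1) l, F.d i w = v := by
  cases i with
  | zero => exact F.exact_zero l v hv
  | succ i => exact F.exact_succ i l v hv

theorem isCycle_d (F : StrandResolution K J) {i : ℕ} {l : P} {v : F.ι (i + 1) →₀ K}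
    (hv : v ∈ F.V (i + 1) l) : F.IsCycle i l (F.d i v) :=
  (F.isCycle_iff (F.d_mem i l v hv)).mpr ⟨v, hv, rfl⟩

/-- The resolution is minimal if no basis vector of degree `l` occurs in a boundary of degree
`l`. -/
def IsMinimal (F : StrandResolution K J) : Prop :=
  ∀ i l, ∀ w ∈ F.V (i + 1) l, ∀ a, F.deg i a = l → F.d i w a = 0

/-- The number of basis elements of homological degree `i` and degree `l`. -/
noncomputable def numBasis (F : StrandResolution K J) (i : ℕ) (l : P) : ℕ :=
  Nat.card {b : F.ι i // b ∈ F.B i ∧ F.deg i b = l}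

/-! ### Uniqueness of the Betti numbers -/

/-- Comparison maps in homological degree `i` between two resolutions: `φ` and `ψ` preserve degrees
and cycles, and `ψ ∘ φ` is the identity up to the boundary of `h` and a map `g` that strictly
decreases degrees and vanishes on cycles. -/
structure Comparison (F G : StrandResolution K J) (i : ℕ) where
  φ : (F.ι i →₀ K) →ₗ[K] (G.ι i →₀ K)
  ψ : (G.ι i →₀ K) →ₗ[K] (F.ι i →₀ K)
  h : (F.ι i →₀ K) →ₗ[K] (F.ι (i + 1) →₀ K)
  g : (F.ι i →₀ K) →ₗ[K] (F.ι i →₀ K)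
  φ_mem : ∀ l, ∀ v ∈ F.V i l, φ v ∈ G.V i l
  ψ_mem : ∀ l, ∀ v ∈ G.V i l, ψ v ∈ F.V i l
  h_mem : ∀ l, ∀ v ∈ F.V i l, h v ∈ F.V (i + 1) l
  φ_cycle : ∀ l, ∀ v ∈ F.V i l, F.IsCycle i l v → G.IsCycle i l (φ v)
  ψ_cycle : ∀ l, ∀ v ∈ G.V i l, G.IsCycle i l v → F.IsCycle i l (ψ v)
  g_strict : ∀ l, ∀ v ∈ F.V i l, ∀ a, F.deg i a = l → g v a = 0
  g_cycle : ∀ l, ∀ v ∈ F.V i l, F.IsCycle i l v → g v = 0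
  eq_add : ∀ l, ∀ v ∈ F.V i l, ψ (φ v) = v + F.d i (h v) + g v

/-- In homological degree `0`, a map over the identity of the resolved module. -/
theorem exists_augmentation_lift (hJ : IsUpperSet J) (F G : StrandResolution K J) :
    ∃ φ : (F.ι 0 →₀ K) →ₗ[K] (G.ι 0 →₀ K), (∀ l, ∀ v ∈ F.V 0 l, φ v ∈ G.V 0 l) ∧
      ∀ l, l ∉ J → ∀ v ∈ F.V 0 l, G.aug (φ v) = F.aug v := by
  classical
  obtain ⟨φ, hφ, hφ'⟩ := exists_strand_lift (B := F.B 0) (deg := F.deg 0) (B' := G.B 0)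
    (deg' := G.deg 0)
    (Finsupp.linearCombination K fun b => if F.deg 0 b ∈ J then 0 else F.aug (Finsupp.single b 1))
    G.aug (by
      intro b hb
      by_cases hbJ : F.deg 0 b ∈ J
      · exact ⟨0, Submodule.zero_mem _, by simp [hbJ]⟩
      · obtain ⟨v, hv, hv1⟩ := G.aug_surjective _ hbJ
        exact ⟨F.aug (Finsupp.single b 1) • v, Submodule.smul_mem _ _ hv, by simp [hbJ, hv1]⟩)
  refine ⟨φ, hφ, fun l hl v hv => ?_⟩
  rw [hφ' l v hv]
  have : F.V 0 l ≤ LinearMap.eqLocus (Finsupp.linearCombination K fun b =>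
      if F.deg 0 b ∈ J then 0 else F.aug (Finsupp.single b 1)) F.aug := by
    refine strand_le_of_single fun b _ hbl => ?_
    have hbJ : F.deg 0 b ∉ J := fun h => hl (hJ hbl h)
    simp [hbJ]
  exact this hv

/-- A map that preserves cycles lifts to the next homological degree. -/
theorem exists_cycle_lift {F G : StrandResolution K J} {i : ℕ}
    (φ : (F.ι i →₀ K) →ₗ[K] (G.ι i →₀ K)) (hφ : ∀ l, ∀ v ∈ F.V i l, φ v ∈ G.V i l)
    (hc : ∀ l, ∀ v ∈ F.V i l, F.IsCycle i l v → G.IsCycle i l (φ v)) :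
    ∃ φ' : (F.ι (i + 1) →₀ K) →ₗ[K] (G.ι (i + 1) →₀ K),
      (∀ l, ∀ v ∈ F.V (i + 1) l, φ' v ∈ G.V (i + 1) l) ∧
      ∀ l, ∀ v ∈ F.V (i + 1) l, G.d i (φ' v) = φ (F.d i v) :=
  exists_strand_lift (φ ∘ₗ F.d i) (G.d i) fun b hb => by
    have hm := single_mem_strand (deg := F.deg (i + 1)) hb (1 : K)
    exact (G.isCycle_iff (hφ _ _ (F.d_mem i _ _ hm))).mp
      (hc _ _ (F.d_mem i _ _ hm) (F.isCycle_d hm))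

/-- Comparison maps exist in every homological degree.  Minimality of `F` makes `g`, which is the
composition of the previous `h` with the differential, strictly decreasing in degree. -/
theorem nonempty_comparison (hJ : IsUpperSet J) (F G : StrandResolution K J) (hF : F.IsMinimal)
    (i : ℕ) : Nonempty (Comparison F G i) := by
  induction i with
  | zero =>
    obtain ⟨φ, hφ, hφa⟩ := exists_augmentation_lift hJ F G
    obtain ⟨ψ, hψ, hψa⟩ := exists_augmentation_lift hJ G F
    obtain ⟨h, hh, hh'⟩ := exists_strand_lift (B := F.B 0) (deg := F.deg 0) (B' := F.B 1)
      (deg' := F.deg 1) (ψ ∘ₗ φ - LinearMap.id) (F.d 0) (by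
        intro b hb
        have hm := single_mem_strand (deg := F.deg 0) hb (1 : K)
        refine (F.exact_zero _ _ (Submodule.sub_mem _ (hψ _ _ (hφ _ _ hm)) hm)).mp ?_
        by_cases hbJ : F.deg 0 b ∈ J
        · exact Or.inl hbJ
        · right
          simp [hψa _ hbJ _ (hφ _ _ hm), hφa _ hbJ _ hm])
    refine ⟨⟨φ, ψ, h, 0, hφ, hψ, hh, ?_, ?_, by simp, by simp, ?_⟩⟩
    · intro l v hv hc
      by_cases hl : l ∈ J
      · exact Or.inl hl
      · exact Or.inr ((hφa l hl v hv).trans (hc.resolve_left hl))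
    · intro l v hv hc
      by_cases hl : l ∈ J
      · exact Or.inl hl
      · exact Or.inr ((hψa l hl v hv).trans (hc.resolve_left hl))
    · intro l v hv
      rw [hh' l v hv]
      simp
  | succ i ih =>
    obtain ⟨c⟩ := ih
    obtain ⟨φ, hφ, hφd⟩ := exists_cycle_lift c.φ c.φ_mem c.φ_cycle
    obtain ⟨ψ, hψ, hψd⟩ := exists_cycle_lift c.ψ c.ψ_mem c.ψ_cycle
    obtain ⟨h, hh, hh'⟩ := exists_strand_lift (B := F.B (i + 1)) (deg := F.deg (i + 1))
      (B' := F.B (i + 2)) (deg' := F.deg (i + 2))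
      (ψ ∘ₗ φ - LinearMap.id - c.h ∘ₗ F.d i) (F.d (i + 1)) (by
        intro b hb
        have hm := single_mem_strand (deg := F.deg (i + 1)) hb (1 : K)
        have hdm := F.d_mem i _ _ hm
        refine (F.exact_succ i _ _ (Submodule.sub_mem _ (Submodule.sub_mem _
          (hψ _ _ (hφ _ _ hm)) hm) (c.h_mem _ _ hdm))).mp ?_
        change F.d i (ψ (φ _) - _ - c.h (F.d i _)) = 0
        rw [map_sub, map_sub, hψd _ _ (hφ _ _ hm), hφd _ _ hm, c.eq_add _ _ hdm,
          c.g_cycle _ _ hdm (F.isCycle_d hm)]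
        abel)
    refine ⟨⟨φ, ψ, h, c.h ∘ₗ F.d i, hφ, hψ, hh, ?_, ?_, ?_, ?_, ?_⟩⟩
    · intro l v hv hc
      change F.d i v = 0 at hc
      change G.d i (φ v) = 0
      rw [hφd l v hv, hc, map_zero]
    · intro l v hv hc
      change G.d i v = 0 at hc
      change F.d i (ψ v) = 0
      rw [hψd l v hv, hc, map_zero]
    · intro l v hv a ha
      -- By minimality the boundary of `v` involves only basis vectors of degree less than `l`.
      have hdv := F.d_mem i l v hv
      have hmem : F.d i v ∈ LinearMap.ker (Finsupp.lapply a ∘ₗ c.h) := by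
        rw [← Finsupp.sum_single (F.d i v)]
        refine Submodule.sum_mem _ fun b hb => ?_
        have hb0 := Finsupp.mem_support_iff.mp hb
        obtain ⟨hbB, hbl⟩ := mem_strand.mp hdv b hb0
        refine apply_eq_zero_of_mem_strand (c.h_mem _ _ (single_mem_strand hbB _)) ?_
        intro hab
        exact hb0 (hF i l v hv b (le_antisymm hbl (ha ▸ hab)))
      exact hmem
    · intro l v hv hc
      change F.d i v = 0 at hc
      rw [LinearMap.comp_apply, hc, map_zero]
    · intro l v hv
      rw [hh' l v hv]
      simp only [LinearMap.sub_apply, LinearMap.comp_apply, LinearMap.id_apply]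
      abel

/-- A minimal resolution has at most as many basis elements, in each degree, as any other resolution
of the same module. -/
theorem IsMinimal.numBasis_le (hJ : IsUpperSet J) {F : StrandResolution K J} (hF : F.IsMinimal)
    (G : StrandResolution K J) (i : ℕ) (l : P) : F.numBasis i l ≤ G.numBasis i l := by
  classical
  obtain ⟨c⟩ := nonempty_comparison hJ F G hF i
  let p : F.ι i → Prop := fun b => b ∈ F.B i ∧ F.deg i b = l
  let q : G.ι i → Prop := fun b => b ∈ G.B i ∧ G.deg i b = l
  have : Finite {b // p b} := ((F.finite_B i).subset fun b hb => hb.1).to_subtype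
  have : Finite {b // q b} := ((G.finite_B i).subset fun b hb => hb.1).to_subtype
  have := Fintype.ofFinite {b // p b}
  have := Fintype.ofFinite {b // q b}
  let T : ({b // p b} →₀ K) →ₗ[K] ({b // q b} →₀ K) :=
    Finsupp.lsubtypeDomain {b | q b} ∘ₗ c.φ ∘ₗ Finsupp.lmapDomain K K Subtype.val
  have hT : Function.Injective T := by
    rw [injective_iff_map_eq_zero]
    intro u hu
    set v : F.ι i →₀ K := Finsupp.mapDomain Subtype.val u with hvdef
    have hv : v ∈ F.V i l := by
      rw [mem_strand]
      intro b hb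
      have := Finsupp.mapDomain_support (Finsupp.mem_support_iff.mpr hb)
      obtain ⟨b', -, rfl⟩ := Finset.mem_image.mp this
      exact ⟨b'.2.1, b'.2.2.le⟩
    -- The components of degree `l` of `φ v` vanish, hence so do those of `ψ (φ v)`.
    have hφv : ∀ b, q b → c.φ v b = 0 := fun b hb => DFunLike.congr_fun hu ⟨b, hb⟩
    have hψ : ∀ a, F.deg i a = l → c.ψ (c.φ v) a = 0 := by
      intro a ha
      have hmem : c.φ v ∈ LinearMap.ker (Finsupp.lapply a ∘ₗ c.ψ) := by
        rw [← Finsupp.sum_single (c.φ v)]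
        refine Submodule.sum_mem _ fun b hb => ?_
        have hb0 := Finsupp.mem_support_iff.mp hb
        obtain ⟨hbB, hbl⟩ := mem_strand.mp (c.φ_mem l v hv) b hb0
        refine apply_eq_zero_of_mem_strand (c.ψ_mem _ _ (single_mem_strand hbB _)) ?_
        intro hab
        exact hb0 (hφv b ⟨hbB, le_antisymm hbl (ha ▸ hab)⟩)
      exact hmem
    ext b
    have h1 := DFunLike.congr_fun (c.eq_add l v hv) b.1
    rw [hψ b.1 b.2.2, Finsupp.add_apply, Finsupp.add_apply, c.g_strict l v hv b.1 b.2.2,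
      hF i l _ (c.h_mem l v hv) b.1 b.2.2, hvdef,
      Finsupp.mapDomain_apply Subtype.val_injective] at h1
    simpa using h1.symm
  have := LinearMap.finrank_le_finrank_of_injective hT
  rw [Module.finrank_finsupp_self, Module.finrank_finsupp_self] at this
  rw [numBasis, numBasis, Nat.card_eq_fintype_card, Nat.card_eq_fintype_card]
  exact this

theorem IsMinimal.numBasis_eq (hJ : IsUpperSet J) {F G : StrandResolution K J} (hF : F.IsMinimal)
    (hG : G.IsMinimal) (i : ℕ) (l : P) : F.numBasis i l = G.numBasis i l :=
  le_antisymm (hF.numBasis_le hJ G i l) (hG.numBasis_le hJ F i l)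

end StrandResolution

/-! ### Splitting a resolution along one variable -/

section Truncation

variable {σ : Type*}

/-- The largest divisor of the monomial `l` in which the exponent of `x` is less than `n`, for
`0 < n`. -/
noncomputable def truncate (x : σ) (n : ℕ) (l : σ →₀ ℕ) : σ →₀ ℕ :=
  l - Finsupp.single x (l x - (n - 1))

theorem le_truncate {x : σ} {n : ℕ} (hn : 0 < n) {a l : σ →₀ ℕ} :
    a ≤ truncate x n l ↔ a ≤ l ∧ a x < n := by
  classical
  simp only [truncate, Finsupp.le_def, Finsupp.tsub_apply, Finsupp.single_apply]
  constructor
  · intro h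
    refine ⟨fun y => (h y).trans (Nat.sub_le _ _), ?_⟩
    have := h x
    rw [if_pos rfl] at this
    omega
  · rintro ⟨h, hx⟩ y
    have := h y
    split_ifs with hxy
    · subst hxy
      omega
    · omega

theorem truncate_le {x : σ} {n : ℕ} (hn : 0 < n) (l : σ →₀ ℕ) : truncate x n l ≤ l :=
  ((le_truncate hn).mp le_rfl).1

theorem truncate_apply_lt {x : σ} {n : ℕ} (hn : 0 < n) (l : σ →₀ ℕ) : truncate x n l x < n :=
  ((le_truncate hn).mp le_rfl).2

end Truncation

namespace StrandResolution

variable {σ K : Type*} [Field K] {J J' : Set (σ →₀ ℕ)}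

/-- The projection to the span of the basis vectors whose degree has exponent of `x` at least
`n`. -/
noncomputable def proj (F : StrandResolution K J) (x : σ) (n i : ℕ) :
    (F.ι i →₀ K) →ₗ[K] (F.ι i →₀ K) :=
  open Classical in
  (Finsupp.supported K K {b | n ≤ F.deg i b x}).subtype ∘ₗ Finsupp.restrictDom K K _

theorem proj_apply_of_le (F : StrandResolution K J) {x : σ} {n i : ℕ} (v : F.ι i →₀ K) {b : F.ι i}
    (hb : n ≤ F.deg i b x) : F.proj x n i v b = v b := by
  classical
  rw [proj, LinearMap.comp_apply, Submodule.subtype_apply, Finsupp.restrictDom_apply]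
  exact Finsupp.filter_apply_pos _ _ hb

theorem proj_apply_of_lt (F : StrandResolution K J) {x : σ} {n i : ℕ} (v : F.ι i →₀ K) {b : F.ι i}
    (hb : F.deg i b x < n) : F.proj x n i v b = 0 := by
  classical
  rw [proj, LinearMap.comp_apply, Submodule.subtype_apply, Finsupp.restrictDom_apply]
  exact Finsupp.filter_apply_neg _ _ (by simpa using hb)

theorem proj_eq_zero_iff (F : StrandResolution K J) {x : σ} {n i : ℕ} {v : F.ι i →₀ K} :
    F.proj x n i v = 0 ↔ ∀ b, v b ≠ 0 → F.deg i b x < n := by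
  refine ⟨fun h b hb => ?_, fun h => Finsupp.ext fun b => ?_⟩
  · by_contra hn
    rw [← F.proj_apply_of_le v (not_lt.mp hn), h] at hb
    exact hb rfl
  · rcases lt_or_ge (F.deg i b x) n with hb | hb
    · exact F.proj_apply_of_lt v hb
    · rw [F.proj_apply_of_le v hb]
      by_contra hv
      exact absurd (h b hv) (not_lt.mpr hb)

theorem proj_eq_self_iff (F : StrandResolution K J) {x : σ} {n i : ℕ} {v : F.ι i →₀ K} :
    F.proj x n i v = v ↔ ∀ b, v b ≠ 0 → n ≤ F.deg i b x := by
  refine ⟨fun h b hb => ?_, fun h => Finsupp.ext fun b => ?_⟩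
  · by_contra hn
    rw [← h, F.proj_apply_of_lt v (not_le.mp hn)] at hb
    exact hb rfl
  · rcases lt_or_ge (F.deg i b x) n with hb | hb
    · rw [F.proj_apply_of_lt v hb]
      by_contra hv
      exact absurd (h b (Ne.symm hv)) (not_le.mpr hb)
    · exact F.proj_apply_of_le v hb

theorem proj_proj (F : StrandResolution K J) (x : σ) (n i : ℕ) (v : F.ι i →₀ K) :
    F.proj x n i (F.proj x n i v) = F.proj x n i v := by
  rw [proj_eq_self_iff]
  intro b hb
  by_contra h
  exact hb (F.proj_apply_of_lt v (not_le.mp h))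

theorem proj_mem (F : StrandResolution K J) (x : σ) (n : ℕ) {i : ℕ} {l : σ →₀ ℕ} {v : F.ι i →₀ K}
    (hv : v ∈ F.V i l) : F.proj x n i v ∈ F.V i l := by
  rw [mem_strand] at hv ⊢
  intro b hb
  refine hv b ?_
  rcases lt_or_ge (F.deg i b x) n with h | h
  · exact absurd (F.proj_apply_of_lt v h) hb
  · rwa [F.proj_apply_of_le v h] at hb

theorem mem_truncate_iff (F : StrandResolution K J) {x : σ} {n : ℕ} (hn : 0 < n) {i : ℕ}
    {l : σ →₀ ℕ} {v : F.ι i →₀ K} :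
    v ∈ F.V i (truncate x n l) ↔ v ∈ F.V i l ∧ F.proj x n i v = 0 := by
  rw [mem_strand, mem_strand, proj_eq_zero_iff]
  simp only [le_truncate hn]
  exact ⟨fun h => ⟨fun b hb => ⟨(h b hb).1, (h b hb).2.1⟩, fun b hb => (h b hb).2.2⟩,
    fun h b hb => ⟨(h.1 b hb).1, (h.1 b hb).2, h.2 b hb⟩⟩

theorem proj_d_eq_zero (F : StrandResolution K J) {x : σ} {n : ℕ} (hn : 0 < n) {i : ℕ}
    {l : σ →₀ ℕ} {v : F.ι (i + 1) →₀ K} (hv : v ∈ F.V (i + 1) l)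
    (h : F.proj x n (i + 1) v = 0) : F.proj x n i (F.d i v) = 0 :=
  ((F.mem_truncate_iff hn).mp (F.d_mem i _ v ((F.mem_truncate_iff hn).mpr ⟨hv, h⟩))).2

theorem proj_d_proj (F : StrandResolution K J) {x : σ} {n : ℕ} (hn : 0 < n) {i : ℕ}
    {l : σ →₀ ℕ} {v : F.ι (i + 1) →₀ K} (hv : v ∈ F.V (i + 1) l) :
    F.proj x n i (F.d i (F.proj x n (i + 1) v)) = F.proj x n i (F.d i v) := by
  have := F.proj_d_eq_zero hn (x := x) (v := v - F.proj x n (i + 1) v)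
    (Submodule.sub_mem _ hv (F.proj_mem x n hv)) (by rw [map_sub, proj_proj, sub_self])
  rw [map_sub, map_sub, sub_eq_zero] at this
  exact this.symm

theorem d_d (F : StrandResolution K J) {i : ℕ} {l : σ →₀ ℕ} {v : F.ι (i + 2) →₀ K}
    (hv : v ∈ F.V (i + 2) l) : F.d i (F.d (i + 1) v) = 0 :=
  F.isCycle_d hv

theorem mem_lower_iff (F : StrandResolution K J) {x : σ} {n : ℕ} (hn : 0 < n) {i : ℕ}
    {l : σ →₀ ℕ} {v : F.ι i →₀ K} :
    v ∈ strand K {b | b ∈ F.B i ∧ F.deg i b x < n} (F.deg i) l ↔ v ∈ F.V i (truncate x n l) := by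
  rw [mem_strand, mem_strand]
  refine forall₂_congr fun b _ => ?_
  rw [le_truncate hn, Set.mem_ofPred_eq]
  tauto

/-- The basis elements with exponent of `x` less than `n` span a subcomplex, whose strands are
the strands of `F` in the truncated degrees. -/
noncomputable def lower (F : StrandResolution K J) (x : σ) {n : ℕ} (hn : 0 < n)
    (hJ : ∀ l, truncate x n l ∈ J ↔ l ∈ J') : StrandResolution K J' where
  ι := F.ι
  B i := {b | b ∈ F.B i ∧ F.deg i b x < n}
  finite_B i := (F.finite_B i).subset fun _ hb => hb.1
  deg := F.deg
  d := F.d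
  aug := F.aug
  d_mem i l v hv := by
    rw [mem_lower_iff F hn] at hv ⊢
    exact F.d_mem i _ v hv
  aug_surjective l hl := by
    simp only [mem_lower_iff F hn]
    exact F.aug_surjective _ (by rwa [hJ])
  exact_zero l v hv := by
    simp only [mem_lower_iff F hn] at hv ⊢
    rw [← hJ]
    exact F.exact_zero _ v hv
  exact_succ i l v hv := by
    simp only [mem_lower_iff F hn] at hv ⊢
    exact F.exact_succ i _ v hv

theorem IsMinimal.lower {F : StrandResolution K J} (hF : F.IsMinimal) (x : σ) {n : ℕ} (hn : 0 < n)
    (hJ : ∀ l, truncate x n l ∈ J ↔ l ∈ J') : (F.lower x hn hJ).IsMinimal := by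
  intro i l w hw a ha
  have hw' : w ∈ F.V (i + 1) (truncate x n l) := (mem_lower_iff F hn).mp hw
  exact hF i l w (strand_mono (truncate_le hn l) hw') a ha

/-- In a minimal resolution, a basis vector is not congruent to a vector of smaller degree modulo
the cycles. -/
theorem IsMinimal.not_isCycle_single_sub {F : StrandResolution K J} (hF : F.IsMinimal) {i : ℕ}
    {b : F.ι i} (hb : b ∈ F.B i) {l : σ →₀ ℕ} (hl : l ≤ F.deg i b) (hbl : ¬ F.deg i b ≤ l)
    {v : F.ι i →₀ K} (hv : v ∈ F.V i l) :
    ¬ F.IsCycle i (F.deg i b) (Finsupp.single b 1 - v) := by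
  intro hc
  obtain ⟨w, hw, hwv⟩ := (F.isCycle_iff
    (Submodule.sub_mem _ (single_mem_strand hb 1) (strand_mono hl hv))).mp hc
  have := hF i _ w hw b rfl
  rw [hwv, Finsupp.sub_apply, Finsupp.single_eq_same, apply_eq_zero_of_mem_strand hv hbl,
    sub_zero] at this
  exact one_ne_zero this

section Dominant

variable {x : σ} {m : σ →₀ ℕ}

theorem truncate_mem_iff (hm : 0 < m x) (hJ : ∀ l, l ∈ J ↔ l ∈ J' ∨ m ≤ l)
    (ht : ∀ l, truncate x (m x) l ∈ J' ↔ l ∈ J') (l : σ →₀ ℕ) :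
    truncate x (m x) l ∈ J ↔ l ∈ J' := by
  rw [hJ, ht, or_iff_left_iff_imp]
  exact fun h => absurd (h x) (not_le.mpr (truncate_apply_lt hm l))

theorem IsMinimal.deg_zero_lt {F : StrandResolution K J} (hF : F.IsMinimal) (hJup : IsUpperSet J)
    (hm : 0 < m x) {b : F.ι 0} (hb : b ∈ F.B 0) : F.deg 0 b x < m x := by
  by_contra hx
  have hbl : ¬ F.deg 0 b ≤ truncate x (m x) (F.deg 0 b) := fun h => hx ((le_truncate hm).mp h).2
  by_cases hbJ : F.deg 0 b ∈ J
  · exact hF.not_isCycle_single_sub hb (truncate_le hm _) hbl (Submodule.zero_mem _) (Or.inl hbJ)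
  · obtain ⟨v, hv, hv1⟩ := F.aug_surjective (truncate x (m x) (F.deg 0 b))
      fun h => hbJ (hJup (truncate_le hm _) h)
    exact hF.not_isCycle_single_sub hb (truncate_le hm _) hbl
      (Submodule.smul_mem _ (F.aug (Finsupp.single b 1)) hv) (Or.inr (by simp [hv1]))

/-- In a minimal resolution for `(m, H)`, where the exponent of `x` in `m` exceeds its exponent in
the generators of `H`, a basis degree in which `x` has at least the same exponent as in `m` is a
multiple of `m`. -/
theorem IsMinimal.le_deg {F : StrandResolution K J} (hF : F.IsMinimal) (hJup : IsUpperSet J)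
    (hm : 0 < m x) (hJ : ∀ l, l ∈ J ↔ l ∈ J' ∨ m ≤ l)
    (ht : ∀ l, truncate x (m x) l ∈ J' ↔ l ∈ J') (i : ℕ) {b : F.ι i} (hb : b ∈ F.B i)
    (hx : m x ≤ F.deg i b x) : m ≤ F.deg i b := by
  induction i with
  | zero => exact absurd (hF.deg_zero_lt hJup hm hb) (not_lt.mpr hx)
  | succ i ih =>
    by_contra hmb
    have hbl : ¬ F.deg (i + 1) b ≤ truncate x (m x) (F.deg (i + 1) b) :=
      fun h => not_lt.mpr hx ((le_truncate hm).mp h).2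
    have hs := single_mem_strand (deg := F.deg (i + 1)) hb (1 : K)
    -- The boundary of the basis vector is a cycle of the truncated degree, hence also the boundary
    -- of a vector of that degree.
    have hd : F.d i (Finsupp.single b 1) ∈ F.V i (truncate x (m x) (F.deg (i + 1) b)) := by
      rw [mem_strand]
      intro a ha
      obtain ⟨haB, hal⟩ := mem_strand.mp (F.d_mem i _ _ hs) a ha
      refine ⟨haB, (le_truncate hm).mpr ⟨hal, ?_⟩⟩
      by_contra hax
      exact hmb ((ih haB (not_lt.mp hax)).trans hal)
    have hc : F.IsCycle i (truncate x (m x) (F.deg (i + 1) b)) (F.d i (Finsupp.single b 1)) := by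
      have := F.isCycle_d hs
      cases i with
      | zero =>
        refine this.imp_left fun h => ?_
        rw [truncate_mem_iff hm hJ ht]
        exact ((hJ _).mp h).resolve_right hmb
      | succ i => exact this
    obtain ⟨w, hw, hwd⟩ := (F.isCycle_iff hd).mp hc
    refine hF.not_isCycle_single_sub hb (truncate_le hm _) hbl hw ?_
    change F.d i _ = 0
    rw [map_sub, hwd, sub_self]

/-- Exactness of the quotient of a resolution by the subcomplex on which the exponent of `x` is
small. -/
theorem exists_proj_d_eq_iff (F : StrandResolution K J) {n : ℕ} (hn : 0 < n) {i : ℕ} {l : σ →₀ ℕ}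
    {v : F.ι (i + 1) →₀ K} (hv : v ∈ F.V (i + 1) l) (hvp : F.proj x n (i + 1) v = v) :
    (∃ w, (w ∈ F.V (i + 2) l ∧ F.proj x n (i + 2) w = w) ∧
      F.proj x n (i + 1) (F.d (i + 1) w) = v) ↔
    ∃ v' ∈ F.V (i + 1) (truncate x n l), F.d i v' = F.d i v := by
  constructor
  · rintro ⟨w, ⟨hw, -⟩, hwv⟩
    refine ⟨v - F.d (i + 1) w, (F.mem_truncate_iff hn).mpr
      ⟨Submodule.sub_mem _ hv (F.d_mem _ _ _ hw), ?_⟩, ?_⟩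
    · rw [map_sub, hvp, hwv, sub_self]
    · rw [map_sub, F.d_d hw, sub_zero]
  · rintro ⟨v', hv', hd⟩
    rw [F.mem_truncate_iff hn] at hv'
    obtain ⟨u, hu, hud⟩ := (F.exact_succ i l (v - v') (Submodule.sub_mem _ hv hv'.1)).mp
      (by rw [map_sub, hd, sub_self])
    refine ⟨F.proj x n _ u, ⟨F.proj_mem x n hu, F.proj_proj x n _ u⟩, ?_⟩
    rw [F.proj_d_proj hn hu, hud, map_sub, hv'.2, hvp, sub_zero]

theorem mem_upper_iff (F : StrandResolution K J) {i : ℕ} {l : σ →₀ ℕ} {v : F.ι i →₀ K} :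
    v ∈ strand K {b | b ∈ F.B i ∧ m x ≤ F.deg i b x} (fun b => F.deg i b - m) l ↔
      v ∈ F.V i (l + m) ∧ F.proj x (m x) i v = v := by
  rw [mem_strand, mem_strand, proj_eq_self_iff]
  simp only [tsub_le_iff_right, Set.mem_ofPred_eq]
  exact ⟨fun h => ⟨fun b hb => ⟨(h b hb).1.1, (h b hb).2⟩, fun b hb => (h b hb).1.2⟩,
    fun h b hb => ⟨⟨(h.1 b hb).1, h.2 b hb⟩, (h.1 b hb).2⟩⟩

/-- In a minimal resolution for `(m, H)`, where the exponent of `x` in `m` exceeds its exponent in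
the generators of `H`, the basis elements with the larger exponents of `x` form a quotient
complex.  Shifted by one homological degree and by the degree `m`, it resolves `S / (H : m)`. -/
noncomputable def upper (F : StrandResolution K J) (hF : F.IsMinimal) (hJup : IsUpperSet J)
    (hm : 0 < m x) (hJ : ∀ l, l ∈ J ↔ l ∈ J' ∨ m ≤ l)
    (ht : ∀ l, truncate x (m x) l ∈ J' ↔ l ∈ J') :
    StrandResolution K {l | l + m ∈ J'} where
  ι i := F.ι (i + 1)
  B i := {b | b ∈ F.B (i + 1) ∧ m x ≤ F.deg (i + 1) b x}
  finite_B i := (F.finite_B _).subset fun _ hb => hb.1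
  deg i b := F.deg (i + 1) b - m
  d i := F.proj x (m x) (i + 1) ∘ₗ F.d (i + 1)
  aug := F.aug ∘ₗ F.d 0
  d_mem i l v hv := by
    rw [mem_upper_iff F] at hv ⊢
    exact ⟨F.proj_mem _ _ (F.d_mem _ _ _ hv.1), F.proj_proj _ _ _ _⟩
  aug_surjective l hl := by
    simp only [mem_upper_iff F]
    have htl : truncate x (m x) (l + m) ∉ J := by
      rw [truncate_mem_iff hm hJ ht]
      exact hl
    obtain ⟨u, hu, hu1⟩ := F.aug_surjective _ htl
    obtain ⟨v, hv, hvd⟩ := (F.exact_zero (l + m) u (strand_mono (truncate_le hm _) hu)).mp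
      (Or.inl ((hJ _).mpr (Or.inr le_add_self)))
    refine ⟨F.proj x (m x) 1 v, ⟨F.proj_mem _ _ hv, F.proj_proj _ _ _ _⟩, ?_⟩
    have hlow : v - F.proj x (m x) 1 v ∈ F.V 1 (truncate x (m x) (l + m)) :=
      (F.mem_truncate_iff hm).mpr ⟨Submodule.sub_mem _ hv (F.proj_mem _ _ hv),
        by rw [map_sub, proj_proj, sub_self]⟩
    have := (F.isCycle_d hlow).resolve_left htl
    rw [map_sub, map_sub, hvd, hu1, sub_eq_zero] at this
    exact this.symm
  exact_zero l v hv := by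
    simp only [mem_upper_iff F] at hv ⊢
    refine Iff.trans ?_ (F.exists_proj_d_eq_iff hm hv.1 hv.2).symm
    have hdv : F.d 0 v ∈ F.V 0 (truncate x (m x) (l + m)) := by
      rw [F.mem_truncate_iff hm, proj_eq_zero_iff]
      refine ⟨F.d_mem _ _ _ hv.1, fun b hb => ?_⟩
      exact hF.deg_zero_lt hJup hm (mem_strand.mp (F.d_mem _ _ _ hv.1) b hb).1
    rw [← F.exact_zero _ _ hdv, truncate_mem_iff hm hJ ht]
    rfl
  exact_succ i l v hv := by
    simp only [mem_upper_iff F] at hv ⊢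
    refine Iff.trans ?_ (F.exists_proj_d_eq_iff hm hv.1 hv.2).symm
    constructor
    · intro h
      exact (F.exact_succ i _ _ ((F.mem_truncate_iff hm).mpr ⟨F.d_mem _ _ _ hv.1, h⟩)).mp
        (F.d_d hv.1)
    · rintro ⟨v', hv', hd⟩
      rw [F.mem_truncate_iff hm] at hv'
      rw [LinearMap.comp_apply, ← hd]
      exact F.proj_d_eq_zero hm hv'.1 hv'.2

theorem IsMinimal.upper {F : StrandResolution K J} (hF : F.IsMinimal) (hJup : IsUpperSet J)
    (hm : 0 < m x) (hJ : ∀ l, l ∈ J ↔ l ∈ J' ∨ m ≤ l)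
    (ht : ∀ l, truncate x (m x) l ∈ J' ↔ l ∈ J') :
    (F.upper hF hJup hm hJ ht).IsMinimal := by
  intro i l w hw a ha
  have hw' := (mem_upper_iff F).mp hw
  change F.proj x (m x) (i + 1) (F.d (i + 1) w) a = 0
  rcases lt_or_ge (F.deg (i + 1) a x) (m x) with hax | hax
  · exact F.proj_apply_of_lt _ hax
  · rw [F.proj_apply_of_le _ hax]
    by_contra hne
    have haB := (mem_strand.mp (F.d_mem _ _ _ hw'.1) a hne).1
    refine hne (hF _ _ w hw'.1 a ?_)
    change F.deg (i + 1) a - m = l at ha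
    rw [← ha, tsub_add_cancel_of_le (hF.le_deg hJup hm hJ ht _ haB hax)]

theorem numBasis_lower (F : StrandResolution K J) {n : ℕ} (hn : 0 < n)
    (hJ : ∀ l, truncate x n l ∈ J ↔ l ∈ J') (i : ℕ) (l : σ →₀ ℕ) :
    (F.lower x hn hJ).numBasis i l = if l x < n then F.numBasis i l else 0 := by
  split_ifs with h
  · refine Nat.card_congr (Equiv.subtypeEquivRight fun b => ?_)
    change (b ∈ F.B i ∧ F.deg i b x < n) ∧ F.deg i b = l ↔ b ∈ F.B i ∧ F.deg i b = l
    constructor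
    · rintro ⟨⟨h1, -⟩, h2⟩
      exact ⟨h1, h2⟩
    · rintro ⟨h1, rfl⟩
      exact ⟨⟨h1, h⟩, rfl⟩
  · have : IsEmpty {b // b ∈ (F.lower x hn hJ).B i ∧ (F.lower x hn hJ).deg i b = l} := by
      refine ⟨?_⟩
      rintro ⟨b, ⟨-, h1⟩, rfl⟩
      exact h h1
    exact Nat.card_of_isEmpty

theorem IsMinimal.numBasis_zero {F : StrandResolution K J} (hF : F.IsMinimal)
    (hJup : IsUpperSet J) (hm : 0 < m x) {l : σ →₀ ℕ} (hl : m x ≤ l x) : F.numBasis 0 l = 0 := by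
  have : IsEmpty {b // b ∈ F.B 0 ∧ F.deg 0 b = l} := by
    refine ⟨?_⟩
    rintro ⟨b, h1, rfl⟩
    exact absurd (hF.deg_zero_lt hJup hm h1) (not_lt.mpr hl)
  exact Nat.card_of_isEmpty

theorem IsMinimal.numBasis_eq_zero {F : StrandResolution K J} (hF : F.IsMinimal)
    (hJup : IsUpperSet J) (hm : 0 < m x) (hJ : ∀ l, l ∈ J ↔ l ∈ J' ∨ m ≤ l)
    (ht : ∀ l, truncate x (m x) l ∈ J' ↔ l ∈ J') {i : ℕ} {l : σ →₀ ℕ} (hx : m x ≤ l x)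
    (hl : ¬ m ≤ l) : F.numBasis i l = 0 := by
  have : IsEmpty {b // b ∈ F.B i ∧ F.deg i b = l} := by
    refine ⟨?_⟩
    rintro ⟨b, h1, rfl⟩
    exact hl (hF.le_deg hJup hm hJ ht i h1 hx)
  exact Nat.card_of_isEmpty

theorem numBasis_upper (F : StrandResolution K J) (hF : F.IsMinimal) (hJup : IsUpperSet J)
    (hm : 0 < m x) (hJ : ∀ l, l ∈ J ↔ l ∈ J' ∨ m ≤ l)
    (ht : ∀ l, truncate x (m x) l ∈ J' ↔ l ∈ J') (i : ℕ) {l : σ →₀ ℕ} (hl : m ≤ l) :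
    (F.upper hF hJup hm hJ ht).numBasis i (l - m) = F.numBasis (i + 1) l := by
  refine Nat.card_congr (Equiv.subtypeEquivRight fun b => ?_)
  change (b ∈ F.B (i + 1) ∧ m x ≤ F.deg (i + 1) b x) ∧ F.deg (i + 1) b - m = l - m ↔
    b ∈ F.B (i + 1) ∧ F.deg (i + 1) b = l
  constructor
  · rintro ⟨⟨h1, h2⟩, h3⟩
    exact ⟨h1, (tsub_left_inj (hF.le_deg hJup hm hJ ht _ h1 h2) hl).mp h3⟩
  · rintro ⟨h1, rfl⟩
    exact ⟨⟨h1, hl x⟩, rfl⟩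

end Dominant

end StrandResolution

open MvPolynomial

/-! ### The strands of a multigraded resolution -/

section Homogeneous

variable {σ K : Type*} [Field K]

theorem coeff_monomial_self (l : σ →₀ ℕ) (r : K) : coeff l (monomial l r) = r := by
  classical
  rw [coeff_monomial, if_pos rfl]

theorem monomial_coeff_injective (l : σ →₀ ℕ) :
    Function.Injective (monomial l : K → MvPolynomial σ K) := fun r s h => by
  rw [← coeff_monomial_self l r, h, coeff_monomial_self]

/-- The vector `w` of polynomials is homogeneous of multidegree `l`, with respect to basis elements
of multidegrees `a`, and its vector of coefficients is `v`. -/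
def HasCoeffs {n : ℕ} (a : Fin n → (σ →₀ ℕ)) (l : σ →₀ ℕ) (v : Fin n →₀ K)
    (w : Fin n → MvPolynomial σ K) : Prop :=
  ∀ b, monomial (a b) 1 * w b = monomial l (v b)

/-- The matrix of scalars underlying a multigraded matrix, as a linear map. -/
noncomputable def scalarMap {n n' : ℕ} (a : Fin n → (σ →₀ ℕ)) (a' : Fin n' → (σ →₀ ℕ))
    (A : Matrix (Fin n) (Fin n') (MvPolynomial σ K)) : (Fin n' →₀ K) →ₗ[K] (Fin n →₀ K) :=
  Finsupp.linearCombination K fun c =>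
    Finsupp.equivFunOnFinite.symm fun b => coeff (a' c) (monomial (a b) 1 * A b c)

variable {n n' : ℕ} {a : Fin n → (σ →₀ ℕ)} {a' : Fin n' → (σ →₀ ℕ)}
  {A : Matrix (Fin n) (Fin n') (MvPolynomial σ K)} {l : σ →₀ ℕ}

theorem scalarMap_apply (v : Fin n' →₀ K) (b : Fin n) :
    scalarMap a a' A v b = ∑ c, v c * coeff (a' c) (monomial (a b) 1 * A b c) := by
  rw [scalarMap, Finsupp.linearCombination_apply, Finsupp.sum_fintype _ _ (by simp),
    Finsupp.finsetSum_apply]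
  simp

theorem HasCoeffs.of_mem_strand {v : Fin n →₀ K} (hv : v ∈ strand K Set.univ a l) :
    ∃ w, HasCoeffs a l v w := by
  refine ⟨fun b => monomial (l - a b) (v b), fun b => ?_⟩
  by_cases hb : a b ≤ l
  · rw [monomial_mul, add_tsub_cancel_of_le hb, one_mul]
  · simp [show v b = 0 from apply_eq_zero_of_mem_strand hv hb]

theorem HasCoeffs.mem_strand {v : Fin n →₀ K} {w : Fin n → MvPolynomial σ K}
    (h : HasCoeffs a l v w) : v ∈ strand K Set.univ a l := by
  rw [MonomialBetti.mem_strand]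
  refine fun b hb => ⟨trivial, ?_⟩
  by_contra hle
  apply hb
  have := congrArg (coeff l) (h b)
  rw [coeff_monomial_mul', if_neg hle, coeff_monomial_self] at this
  exact this.symm

theorem HasCoeffs.left_unique {v v' : Fin n →₀ K} {w : Fin n → MvPolynomial σ K}
    (h : HasCoeffs a l v w) (h' : HasCoeffs a l v' w) : v = v' := by
  ext b
  exact (monomial_coeff_injective l) ((h b).symm.trans (h' b))

theorem HasCoeffs.right_unique {v : Fin n →₀ K} {w w' : Fin n → MvPolynomial σ K}
    (h : HasCoeffs a l v w) (h' : HasCoeffs a l v w') : w = w' := by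
  funext b
  exact mul_left_cancel₀ (by simp) ((h b).trans (h' b).symm)

theorem hasCoeffs_zero : HasCoeffs a l (0 : Fin n →₀ K) 0 := by
  intro b
  simp

theorem exists_hasCoeffs_component (a : Fin n → (σ →₀ ℕ)) (l : σ →₀ ℕ)
    (w : Fin n → MvPolynomial σ K) : ∃ v, HasCoeffs a l v (component a l w) :=
  ⟨Finsupp.equivFunOnFinite.symm fun b => coeff l (monomial (a b) 1 * w b),
    fun b => monomial_mul_component a l w b⟩

theorem HasCoeffs.component_eq {v : Fin n →₀ K} {w : Fin n → MvPolynomial σ K}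
    (h : HasCoeffs a l v w) : component a l w = w := by
  funext b
  refine mul_left_cancel₀ (a := monomial (a b) (1 : K)) (by simp) ?_
  rw [monomial_mul_component, h b, coeff_monomial_self]

theorem monomial_mul_eq_of_homogeneous
    (hA : ∀ b c, ∃ r : K, monomial (a b) 1 * A b c = monomial (a' c) r)
    (b : Fin n) (c : Fin n') :
    monomial (a b) 1 * A b c = monomial (a' c) (coeff (a' c) (monomial (a b) 1 * A b c)) := by
  obtain ⟨r, hr⟩ := hA b c
  rw [hr, coeff_monomial_self]

theorem HasCoeffs.mulVec (hA : ∀ b c, ∃ r : K, monomial (a b) 1 * A b c = monomial (a' c) r)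
    {v : Fin n' →₀ K} {w : Fin n' → MvPolynomial σ K} (h : HasCoeffs a' l v w) :
    HasCoeffs a l (scalarMap a a' A v) (A.mulVec w) := by
  intro b
  rw [Matrix.mulVec, dotProduct, Finset.mul_sum, scalarMap_apply, map_sum]
  refine Finset.sum_congr rfl fun c _ => ?_
  obtain ⟨r, hr⟩ := hA b c
  rw [← mul_assoc, hr, coeff_monomial_self,
    show monomial (a' c) r = C r * monomial (a' c) 1 by rw [C_mul_monomial, mul_one],
    mul_assoc, h c, C_mul_monomial, mul_comm]

/-- A vector of a strand is a boundary if and only if the corresponding homogeneous vector of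
polynomials is one: only the component of degree `l` of a preimage matters. -/
theorem exists_scalarMap_eq_iff
    (hA : ∀ b c, ∃ r : K, monomial (a b) 1 * A b c = monomial (a' c) r)
    {v : Fin n →₀ K} {w : Fin n → MvPolynomial σ K} (h : HasCoeffs a l v w) :
    (∃ u ∈ strand K Set.univ a' l, scalarMap a a' A u = v) ↔ w ∈ Set.range A.mulVecLin := by
  constructor
  · rintro ⟨u, hu, rfl⟩
    obtain ⟨p, hp⟩ := HasCoeffs.of_mem_strand hu
    exact ⟨p, (hp.mulVec hA).right_unique h⟩
  · rintro ⟨p, rfl⟩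
    obtain ⟨u, hu⟩ := exists_hasCoeffs_component a' l p
    refine ⟨u, hu.mem_strand, (hu.mulVec hA).left_unique ?_⟩
    rw [mulVec_component a a' A hA]
    have := h.component_eq
    rw [Matrix.mulVecLin_apply] at this h
    rwa [this]

end Homogeneous

section Monomial

variable {σ K : Type*} [Field K]

/-- The exponent vectors of the monomials of the ideal generated by `G`. -/
def multiples (G : Set (σ →₀ ℕ)) : Set (σ →₀ ℕ) :=
  {l | ∃ g ∈ G, g ≤ l}

theorem isUpperSet_multiples (G : Set (σ →₀ ℕ)) : IsUpperSet (multiples G) :=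
  fun _ _ h ⟨g, hg, hl⟩ => ⟨g, hg, hl.trans h⟩

theorem coeff_eq_zero_of_mem_monomialIdeal {G : Set (σ →₀ ℕ)} {p : MvPolynomial σ K}
    (hp : p ∈ monomialIdeal K G) {l : σ →₀ ℕ} (hl : l ∉ multiples G) : coeff l p = 0 := by
  rw [monomialIdeal, mem_ideal_span_monomial_image] at hp
  by_contra h
  exact hl (hp l (mem_support_iff.mpr h))

theorem monomial_mem_monomialIdeal_iff {G : Set (σ →₀ ℕ)} {l : σ →₀ ℕ} {r : K} :
    monomial l r ∈ monomialIdeal K G ↔ l ∈ multiples G ∨ r = 0 := by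
  constructor
  · intro h
    by_cases hl : l ∈ multiples G
    · exact Or.inl hl
    · right
      rw [← coeff_monomial_self l r, coeff_eq_zero_of_mem_monomialIdeal h hl]
  · rintro (⟨g, hg, hl⟩ | rfl)
    · rw [← add_tsub_cancel_of_le hl, ← one_mul r, ← monomial_mul]
      exact Ideal.mul_mem_right _ _ (Ideal.subset_span ⟨g, hg, rfl⟩)
    · simp

namespace MultigradedResolution

variable {G : Set (σ →₀ ℕ)} (F : MultigradedResolution (monomialIdeal K G))

/-- The scalars that describe the augmentation on basis elements.  The scalar is not determined by
the augmentation if the monomial of its multidegree lies in the ideal; any choice will do. -/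
noncomputable def augScalar (b : Fin (F.rank 0)) : K :=
  (F.aug_homogeneous b).choose

theorem aug_eq (w : Fin (F.rank 0) → MvPolynomial σ K) : F.aug w =
    Ideal.Quotient.mk _ (∑ b, C (F.augScalar b) * (monomial (F.mdeg 0 b) 1 * w b)) := by
  rw [map_sum]
  conv_lhs => rw [pi_eq_sum_univ' w, map_sum]
  refine Finset.sum_congr rfl fun b _ => ?_
  have h := (F.aug_homogeneous b).choose_spec
  change _ = Ideal.Quotient.mk _ (monomial (F.mdeg 0 b) (F.augScalar b)) at h
  rw [map_smul, h, ← mul_assoc, C_mul_monomial, mul_one, mul_comm, map_mul]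
  rfl

theorem aug_of_hasCoeffs {l : σ →₀ ℕ} {v : Fin (F.rank 0) →₀ K}
    {w : Fin (F.rank 0) → MvPolynomial σ K} (h : HasCoeffs (F.mdeg 0) l v w) : F.aug w =
    Ideal.Quotient.mk _ (monomial l (Finsupp.linearCombination K F.augScalar v)) := by
  rw [F.aug_eq, Finsupp.linearCombination_apply, Finsupp.sum_fintype _ _ (by simp),
    map_sum (monomial l)]
  congr 1
  refine Finset.sum_congr rfl fun b _ => ?_
  rw [h b, C_mul_monomial, smul_eq_mul, mul_comm]

/-- The strands of a multigraded resolution of `S / I`. -/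
noncomputable def toStrand : StrandResolution K (multiples G) where
  ι i := Fin (F.rank i)
  B _ := Set.univ
  finite_B _ := Set.finite_univ
  deg := F.mdeg
  d i := scalarMap (F.mdeg i) (F.mdeg (i + 1)) (F.d i)
  aug := Finsupp.linearCombination K F.augScalar
  d_mem i l v hv := by
    obtain ⟨w, hw⟩ := HasCoeffs.of_mem_strand hv
    exact (hw.mulVec (F.d_homogeneous i)).mem_strand
  aug_surjective l hl := by
    obtain ⟨w, hw⟩ := F.aug_surjective (Ideal.Quotient.mk _ (monomial l 1))
    obtain ⟨v, hv⟩ := exists_hasCoeffs_component (F.mdeg 0) l w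
    refine ⟨v, hv.mem_strand, ?_⟩
    rw [F.aug_eq, Ideal.Quotient.eq] at hw
    have h := coeff_eq_zero_of_mem_monomialIdeal hw hl
    rw [coeff_sub, coeff_monomial_self, sub_eq_zero, coeff_sum] at h
    rw [← h, Finsupp.linearCombination_apply, Finsupp.sum_fintype _ _ (by simp)]
    refine Finset.sum_congr rfl fun b _ => ?_
    have hb := hv b
    rw [monomial_mul_component] at hb
    rw [coeff_C_mul, monomial_coeff_injective l hb, smul_eq_mul, mul_comm]
  exact_zero l v hv := by
    obtain ⟨w, hw⟩ := HasCoeffs.of_mem_strand hv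
    rw [exists_scalarMap_eq_iff (F.d_homogeneous 0) hw, ← F.exact_zero w, F.aug_of_hasCoeffs hw,
      Ideal.Quotient.eq_zero_iff_mem, monomial_mem_monomialIdeal_iff]
  exact_succ i l v hv := by
    obtain ⟨w, hw⟩ := HasCoeffs.of_mem_strand hv
    rw [exists_scalarMap_eq_iff (F.d_homogeneous (i + 1)) hw, ← F.exact_succ i w]
    have h := hw.mulVec (F.d_homogeneous i)
    rw [Matrix.mulVecLin_apply]
    constructor
    · intro h0
      rw [h0] at h
      exact h.right_unique hasCoeffs_zero
    · intro h0
      rw [h0] at h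
      exact h.left_unique hasCoeffs_zero

theorem IsMinimal.toStrand {F : MultigradedResolution (monomialIdeal K G)} (hF : F.IsMinimal) :
    F.toStrand.IsMinimal := by
  intro i l w hw a ha
  refine (scalarMap_apply (a := F.mdeg i) (a' := F.mdeg (i + 1)) (A := F.d i) w a).trans ?_
  refine Finset.sum_eq_zero fun c _ => ?_
  by_contra hne
  obtain ⟨hw0, hc0⟩ := mul_ne_zero_iff.mp hne
  have hcl : F.mdeg (i + 1) c ≤ l := (mem_strand.mp hw c hw0).2
  have hac : F.mdeg i a ≤ F.mdeg (i + 1) c := by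
    by_contra h
    rw [coeff_monomial_mul', if_neg h] at hc0
    exact hc0 rfl
  -- The two degrees agree, so the matrix entry is a nonzero constant.
  have heq : F.mdeg (i + 1) c = F.mdeg i a := le_antisymm (hcl.trans_eq ha.symm) hac
  have h := monomial_mul_eq_of_homogeneous (F.d_homogeneous i) a c
  generalize coeff (F.mdeg (i + 1) c) (monomial (F.mdeg i a) 1 * F.d i a c) = r at h hc0
  rw [heq, ← mul_one r, ← C_mul_monomial, mul_comm (C r)] at h
  refine hF i a c ?_
  rw [mul_left_cancel₀ (by simp) h]
  exact (Ne.isUnit hc0).map C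

theorem numBasis_natCast (i : ℕ) (l : σ →₀ ℕ) :
    F.numBasis i (fun x => (l x : ℤ)) = F.toStrand.numBasis i l := by
  refine Nat.card_congr ⟨fun e => ⟨Fin.cast (congrArg F.rank (by exact_mod_cast e.2.1)) e.1.2,
    trivial, ?_⟩, fun b => ⟨⟨i, b.1⟩, rfl, fun x => ?_⟩, ?_, ?_⟩
  · obtain ⟨⟨j, b⟩, hj, hl⟩ := e
    obtain rfl : j = i := by exact_mod_cast hj
    refine Finsupp.ext fun x => ?_
    have := hl x
    exact Nat.cast_injective (R := ℤ) this
  · exact congrArg (fun a : σ →₀ ℕ => (a x : ℤ)) b.2.2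
  · rintro ⟨⟨j, b⟩, hj, hl⟩
    obtain rfl : j = i := by exact_mod_cast hj
    rfl
  · rintro ⟨b, hb⟩
    rfl

theorem numBasis_eq_zero_of_neg {k : ℤ} (hk : k < 0) (l : σ → ℤ) : F.numBasis k l = 0 := by
  have : IsEmpty {e : Σ i, Fin (F.rank i) // (e.1 : ℤ) = k ∧ ∀ x, (F.mdeg e.1 e.2 x : ℤ) = l x} :=
    ⟨fun e => by have := e.2.1; omega⟩
  exact Nat.card_of_isEmpty

theorem numBasis_eq_zero_of_apply_neg (k : ℤ) {l : σ → ℤ} {x : σ} (hx : l x < 0) :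
    F.numBasis k l = 0 := by
  have : IsEmpty {e : Σ i, Fin (F.rank i) // (e.1 : ℤ) = k ∧ ∀ x, (F.mdeg e.1 e.2 x : ℤ) = l x} :=
    ⟨fun e => by have := e.2.2 x; omega⟩
  exact Nat.card_of_isEmpty

end MultigradedResolution

end Monomial

/-! ### Least common multiples of dominant monomials -/

section LeastCommonMultiple

variable {σ : Type*}

theorem sup_tsub_const {τ : Type*} (s : Finset τ) (m : τ → (σ →₀ ℕ)) (a : σ →₀ ℕ) :
    (s.sup fun r => m r - a) = s.sup m - a := by
  classical
  induction s using Finset.induction with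
  | empty => simp [bot_eq_zero]
  | insert r s _ ih =>
    rw [Finset.sup_insert, Finset.sup_insert, ih]
    ext y
    simp only [Finsupp.sup_apply, Finsupp.tsub_apply]
    omega

/-- Distinct sets of dominant monomials have distinct least common multiples. -/
theorem injective_sup {τ : Type*} {m : τ → (σ →₀ ℕ)}
    (hdom : ∀ r, ∃ x, 0 < m r x ∧ ∀ r', r' ≠ r → m r' x < m r x) :
    Function.Injective fun R : Finset τ => R.sup m := by
  have key : ∀ R R' : Finset τ, R.sup m = R'.sup m → R ⊆ R' := by
    intro R R' h r hr
    by_contra hr'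
    obtain ⟨x, hx0, hx⟩ := hdom r
    have h1 : m r x ≤ R'.sup m x := (h ▸ Finset.le_sup hr : m r ≤ R'.sup m) x
    -- At the dominant variable of `m r`, the least common multiples of sets without `r` are smaller.
    have h2 : ∀ S : Finset τ, r ∉ S → S.sup m x < m r x := by
      classical
      intro S hS
      induction S using Finset.induction with
      | empty => simpa [bot_eq_zero] using hx0
      | insert r' S _ ih =>
        rw [Finset.mem_insert, not_or] at hS
        rw [Finset.sup_insert, Finsupp.sup_apply]
        exact max_lt (hx r' (Ne.symm hS.1)) (ih hS.2)
    exact absurd h1 (not_le.mpr (h2 R' hr'))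
  exact fun R R' h => (key R R' h).antisymm (key R' R h.symm)

end LeastCommonMultiple

/-! ### Betti numbers of monomial ideals -/

section Betti

variable {σ K : Type*} [Finite σ] [Field K]

theorem exists_betti_eq (K : Type*) [Field K] (G : Set (σ →₀ ℕ)) :
    ∃ F : MultigradedResolution (monomialIdeal K G), F.IsMinimal ∧
      ∀ k l, betti (monomialIdeal K G) k l = F.numBasis k l := by
  have h := exists_isMinimal (K := K) G
  refine ⟨h.choose, h.choose_spec, fun k l => ?_⟩
  rw [betti, dif_pos h]

theorem betti_eq_zero_of_neg (G : Set (σ →₀ ℕ)) {k : ℤ} (hk : k < 0) (l : σ → ℤ) :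
    betti (monomialIdeal K G) k l = 0 := by
  obtain ⟨F, -, h⟩ := exists_betti_eq K G
  rw [h, F.numBasis_eq_zero_of_neg hk]

theorem betti_eq_zero_of_apply_neg (G : Set (σ →₀ ℕ)) (k : ℤ) {l : σ → ℤ} {x : σ}
    (hx : l x < 0) : betti (monomialIdeal K G) k l = 0 := by
  obtain ⟨F, -, h⟩ := exists_betti_eq K G
  rw [h, F.numBasis_eq_zero_of_apply_neg k hx]

/-- Every minimal resolution by strands computes the Betti numbers. -/
theorem betti_eq_numBasis {G : Set (σ →₀ ℕ)} {J : Set (σ →₀ ℕ)} (hJ : J = multiples G)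
    {F : StrandResolution K J} (hF : F.IsMinimal) (i : ℕ) (l : σ →₀ ℕ) :
    betti (monomialIdeal K G) i (fun x => (l x : ℤ)) = F.numBasis i l := by
  subst hJ
  obtain ⟨F', hF', h⟩ := exists_betti_eq K G
  rw [h, F'.numBasis_natCast]
  exact hF'.toStrand.numBasis_eq (isUpperSet_multiples G) hF i l

/-- Splitting off a generator `m` that is dominant in `{m} ∪ H`: the long exact sequence of
`Tor(-, K)` of `0 → (S / (H : m))(-m) → S / H → S / (m, H) → 0` breaks up into short exact ones.
The generator `lcm(m, g) / m` of `H : m` has the exponent vector `g - m`. -/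
theorem betti_insert {H : Set (σ →₀ ℕ)} {m : σ →₀ ℕ} {x : σ} (hm : 0 < m x)
    (hH : ∀ g ∈ H, g x < m x) (k : ℤ) (l : σ → ℤ) :
    betti (monomialIdeal K (insert m H)) k l = betti (monomialIdeal K H) k l +
      betti (monomialIdeal K ((fun g => g - m) '' H)) (k - 1) (fun y => l y - m y) := by
  by_cases hl : ∃ y, l y < 0
  · obtain ⟨y, hy⟩ := hl
    rw [betti_eq_zero_of_apply_neg _ _ hy, betti_eq_zero_of_apply_neg _ _ hy,
      betti_eq_zero_of_apply_neg _ _ (x := y) (by omega)]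
  by_cases hk : k < 0
  · rw [betti_eq_zero_of_neg _ hk, betti_eq_zero_of_neg _ hk, betti_eq_zero_of_neg _ (by omega)]
  obtain ⟨l, rfl⟩ : ∃ l' : σ →₀ ℕ, l = fun y => (l' y : ℤ) := by
    push Not at hl
    refine ⟨Finsupp.equivFunOnFinite.symm fun y => (l y).toNat, ?_⟩
    funext y
    simp [Int.toNat_of_nonneg (hl y)]
  lift k to ℕ using not_lt.mp hk
  obtain ⟨F', hF', -⟩ := exists_betti_eq K (insert m H)
  set F := F'.toStrand
  have hF : F.IsMinimal := hF'.toStrand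
  have hup := isUpperSet_multiples (insert m H)
  have hJ : ∀ l, l ∈ multiples (insert m H) ↔ l ∈ multiples H ∨ m ≤ l := by
    intro l
    simp only [multiples, Set.mem_ofPred_eq, Set.exists_mem_insert]
    exact or_comm
  have ht : ∀ l, truncate x (m x) l ∈ multiples H ↔ l ∈ multiples H := fun l =>
    exists_congr fun g => and_congr_right fun hg =>
      (le_truncate hm).trans (and_iff_left (hH g hg))
  have hcolon : {l | l + m ∈ multiples H} = multiples ((fun g => g - m) '' H) := by
    ext l
    simp [multiples]
  rw [betti_eq_numBasis rfl hF, betti_eq_numBasis rfl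
    (hF.lower x hm (StrandResolution.truncate_mem_iff hm hJ ht)), StrandResolution.numBasis_lower]
  by_cases hml : m ≤ l
  · rw [if_neg (not_lt.mpr (hml x)), zero_add]
    have hsub : (fun y => (l y : ℤ) - (m y : ℤ)) = fun y => ((l - m : σ →₀ ℕ) y : ℤ) := by
      funext y
      rw [Finsupp.tsub_apply, Nat.cast_sub (hml y)]
    rw [hsub]
    cases k with
    | zero =>
      rw [hF.numBasis_zero hup hm (hml x), betti_eq_zero_of_neg _ (by simp)]
    | succ k =>
      rw [Nat.cast_succ, add_sub_cancel_right,
        betti_eq_numBasis hcolon (hF.upper hup hm hJ ht), F.numBasis_upper hF hup hm hJ ht k hml]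
  · obtain ⟨y, hy⟩ : ∃ y, l y < m y := by
      simpa [Finsupp.le_def] using hml
    rw [betti_eq_zero_of_apply_neg _ _ (x := y) (by simpa using hy), add_zero]
    split_ifs with hx
    · rfl
    · exact hF.numBasis_eq_zero hup hm hJ ht (not_lt.mp hx) hml

/-- The decomposition of the Betti numbers along any number of dominant generators, indexed by the
sets of these generators. -/
theorem betti_image_union {τ : Type*} (s : Finset τ) (m : τ → (σ →₀ ℕ)) (H : Set (σ →₀ ℕ))
    (hdom : ∀ r ∈ s, ∃ x, 0 < m r x ∧ (∀ r' ∈ s, r' ≠ r → m r' x < m r x) ∧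
      ∀ g ∈ H, g x < m r x) (k : ℤ) (l : σ → ℤ) :
    betti (monomialIdeal K (m '' s ∪ H)) k l = ∑ R ∈ s.powerset,
      betti (monomialIdeal K ((fun g => g - R.sup m) '' H)) (k - R.card)
        (fun y => l y - (R.sup m y : ℕ)) := by
  classical
  induction s using Finset.induction generalizing m H k l with
  | empty => simp [bot_eq_zero]
  | insert r s hr ih =>
    obtain ⟨x, hx0, hxs, hxH⟩ := hdom r (Finset.mem_insert_self r s)
    rw [Finset.coe_insert, Set.image_insert_eq, Set.insert_union, betti_insert hx0,
      Finset.sum_powerset_insert hr]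
    · congr 1
      · refine ih m H (fun r' hr' => ?_) k l
        obtain ⟨y, hy0, hys, hyH⟩ := hdom r' (Finset.mem_insert_of_mem hr')
        exact ⟨y, hy0, fun r'' h => hys r'' (Finset.mem_insert_of_mem h), hyH⟩
      · rw [Set.image_union, Set.image_image, ih (fun r' => m r' - m r)]
        · refine Finset.sum_congr rfl fun R hR => ?_
          have hrR : r ∉ R := fun h => hr (Finset.mem_powerset.mp hR h)
          have hadd : m r + (R.sup m - m r) = (insert r R).sup m := by
            rw [Finset.sup_insert]
            ext y
            simp only [Finsupp.add_apply, Finsupp.sup_apply, Finsupp.tsub_apply]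
            omega
          rw [Set.image_image, sup_tsub_const, Finset.card_insert_of_notMem hrR, ← hadd]
          congr 1
          · simp only [tsub_tsub]
          · push_cast
            ring
          · funext y
            rw [Finsupp.add_apply]
            push_cast
            ring
        · intro r' hr'
          -- The variable that makes `m r'` dominant still does so after division by `m r`.
          obtain ⟨y, -, hys, hyH⟩ := hdom r' (Finset.mem_insert_of_mem hr')
          have hlt := hys r (Finset.mem_insert_self r s) fun h => hr (h ▸ hr')
          refine ⟨y, ?_, fun r'' hr'' hne => ?_, ?_⟩
          · rw [Finsupp.tsub_apply]
            omega
          · have := hys r'' (Finset.mem_insert_of_mem hr'') hne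
            rw [Finsupp.tsub_apply, Finsupp.tsub_apply]
            omega
          · rintro _ ⟨g, hg, rfl⟩
            have := hyH g hg
            rw [Finsupp.tsub_apply, Finsupp.tsub_apply]
            omega
    · rintro g (⟨r', hr', rfl⟩ | hg)
      · exact hxs r' (Finset.mem_insert_of_mem hr') fun h => hr (h ▸ hr')
      · exact hxH g hg

end Betti

end MonomialBetti

/-! ### Decomposition along the dominant generators -/

theorem mainTheorem1 {σ K : Type*} [Finite σ] [Field K] (M : Ideal (MvPolynomial σ K))
    {d c : ℕ} (m : Fin d → (σ →₀ ℕ)) (h : Fin c → (σ →₀ ℕ))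
    (hinj : Function.Injective (Sum.elim m h))
    (hgen : MonomialBetti.IsMinimalGeneratingSet M (Set.range (Sum.elim m h)))
    (hdom : ∀ r, MonomialBetti.IsDominant (Set.range (Sum.elim m h)) (m r))
    (hd : 1 ≤ d) (k : ℤ) (l : σ →₀ ℕ) :
    MonomialBetti.betti M k (fun x => (l x : ℤ)) =
      ∑ p ∈ MonomialBetti.decompositionPairs m c,
        MonomialBetti.betti (MonomialBetti.decompositionIdeal M h p.2)
          (k - (p.1 : ℤ)) (fun x => (l x : ℤ) - (p.2 x : ℤ)) := by
  classical
  -- If `c = 0`, the sum has one summand, which is the left hand side.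
  by_cases hc : c = 0
  · rw [MonomialBetti.decompositionPairs, if_pos hc, Finset.sum_singleton,
      MonomialBetti.decompositionIdeal, if_pos hc]
    simp
  -- Since there is a monomial `h i`, the dominant variable occurs in `m r`.
  have hdom' : ∀ r, ∃ x, 0 < m r x ∧ (∀ r', r' ≠ r → m r' x < m r x) ∧
      ∀ i, h i x < m r x := by
    intro r
    obtain ⟨-, x, hx⟩ := hdom r
    have hh : ∀ i, h i x < m r x := fun i =>
      hx _ ⟨Sum.inr i, rfl⟩ fun e => by simpa using hinj (a₁ := Sum.inr i) (a₂ := Sum.inl r) e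
    refine ⟨x, (Nat.zero_le _).trans_lt (hh ⟨0, Nat.pos_of_ne_zero hc⟩), fun r' hr' => ?_, hh⟩
    exact hx _ ⟨Sum.inl r', rfl⟩ fun e =>
      hr' (by simpa using hinj (a₁ := Sum.inl r') (a₂ := Sum.inl r) e)
  have hinjsup := MonomialBetti.injective_sup fun r =>
    let ⟨x, hx0, hx, _⟩ := hdom' r
    ⟨x, hx0, hx⟩
  have hM : M = MonomialBetti.monomialIdeal K
      (m '' (Finset.univ : Finset (Fin d)) ∪ Set.range h) := by
    rw [← hgen.1, Set.Sum.elim_range, Finset.coe_univ, Set.image_univ]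
  rw [MonomialBetti.decompositionPairs, if_neg hc, Finset.sum_image]
  · conv_lhs => rw [hM]
    rw [MonomialBetti.betti_image_union, Finset.powerset_univ]
    · refine Finset.sum_congr rfl fun R _ => ?_
      have hset : (fun g => g - R.sup m) '' Set.range h =
          Set.range fun i => (R.sup m ⊔ h i) - R.sup m := by
        rw [← Set.range_comp]
        congr 1
        funext i
        ext x
        simp only [Function.comp_apply, Finsupp.tsub_apply, Finsupp.sup_apply]
        omega
      rw [MonomialBetti.decompositionIdeal, if_neg hc, hset]
    · intro r _
      obtain ⟨x, hx0, hx, hxh⟩ := hdom' r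
      refine ⟨x, hx0, fun r' _ => hx r', ?_⟩
      rintro _ ⟨i, rfl⟩
      exact hxh i
  · exact fun R _ R' _ e => hinjsup (congrArg Prod.snd e)
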